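/- An infostation has a cache memory of capacity $M$ and serves files $1,\dots,F$ ($F\ge 1$) of sizes $S_f>0$; $U>0$ is the maximum number of users. The normalised demands $d_f^t\in[0,1]$ ($t=1,2,\dots$) have means $\theta_f$; the demand vectors $(d^t_f)_f$ are i.i.d. over $t$. A cache content is a set $\mathcal M$ of files with $\sum_{f\in\mathcal M}S_f\le M$; under a profile $\mu$ its expected reward per period is $r_\mu(\mathcal M)=U\sum_{f\in\mathcal M}S_f\mu_f$, and replacing $\widehat{\mathcal M}$ by $\mathcal M$ costs $c(\mathcal M,\widehat{\mathcal M})=\sum_{f\in\mathcal M\setminus\widehat{\mathcal M}}S_f$. Put $r_{opt}=\max_{\mathcal M}r_\Theta(\mathcal M)$ with $\Theta=(\theta_f)_f$, and assume that the maximiser is unique. Let $\Delta_u$ and $\Delta_l$ be $r_{opt}$ minus the smallest, respectively the largest, value of $r_\Theta(\mathcal M)$ over the cache contents with $r_\Theta(\mathcal M)<r_{opt}$, let $M_u=\max_{\mathcal M,\widehat{\mathcal M}}c(\mathcal M,\widehat{\mathcal M})$, and let $g$ be an invertible linear function with $|r_\mu(\mathcal M)-r_{\mu'}(\mathcal M)|\le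 g(\Lambda)$ for all cache contents $\mathcal M$ whenever $\max_f|\mu_f-\mu'_f|\le\Lambda$. The CUCBSC algorithm with an exact solver ($\alpha=\beta=1$) and $\Delta(j)=L\ge 1$ starts with an empty cache, $\mathcal M^0=\emptyset$, and caches every file at least once during periods $1,\dots,F$. At each switching period $t=n_b=F+1+(b-1)L$, $b\ge1$, it caches a set $\mathcal M^t$ that maximises $r_{\tilde\theta}$ for $\tilde\theta_f=\hat\theta_f+\sqrt{3\log t/(2T_f)}$, where $T_f$ is the number of previous periods in which $f$ was cached and $\hat\theta_f$ is the mean of the demands for $f$ observed in them; it keeps this content for $L$ periods. All decisions are non-anticipating. For $w\ge0$ let $$R(t)=t\,r_{opt}-\mathbb E\Big[\sum_{i=1}^t r_\Theta(\mathcal M^i)\Big]+w\Big(\mathbb E\Big[\sum_{i=1}^t c(\mathcal M^i,\mathcal M^{i-1})\Big]-M\Big)$$ be the regret with switching cost. Then for every $t\ge1$ $$R(t)\le\frac{6F\log t}{(g^{-1}(\Delta_l))^2}\Big(\Delta_u+w\frac{2M_u}{L}\Big)+F\Delta_u\Big(\frac{\pi^2}{3}+L\Big)+\frac{wF\cdot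 2M_u}{L}\Big(\frac{\pi^2}{3L}+\frac{3L}{2}-1+\frac{\log\big(1+\frac{L-1}{F+1}\big)}{(g^{-1}(\Delta_l))^2}\Big).$$ In particular, for $w=0$ and $L=1$ this is the CUCB bound $R(t)\le\big(\frac{6\log t}{(g^{-1}(\Delta_l))^2}+\frac{\pi^2}{3}+1\big)F\Delta_u$. -/

import Mathlib

open MeasureTheory ProbabilityTheory

noncomputable section

namespace Caching

/-- An infostation serving `F` files: the maximal number `users` of users that can be served in a
period, the file sizes, and the capacity of the cache memory. -/
structure Infostation (F : ℕ) where
  users : ℝ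
  users_pos : 0 < users
  size : Fin F → ℝ
  size_pos : ∀ f, 0 < size f
  capacity : ℝ

variable {F : ℕ}

namespace Infostation

/-- A cache content (arm combination) is feasible if it fits into the cache memory. -/
def Feasible (I : Infostation F) (A : Finset (Fin F)) : Prop :=
  ∑ f ∈ A, I.size f ≤ I.capacity

/-- Expected instantaneous total reward of the cache content `A` under the popularity
profile `θ`. -/
def reward (I : Infostation F) (θ : Fin F → ℝ) (A : Finset (Fin F)) : ℝ :=
  I.users * ∑ f ∈ A, I.size f * θ f

/-- Cost of replacing the cache content `B` by `A`: the total size of the added files. -/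
def switchCost (I : Infostation F) (A B : Finset (Fin F)) : ℝ :=
  ∑ f ∈ A \ B, I.size f

/-- `A` is an optimal solution of the single-period optimization problem for the profile `θ`. -/
def IsOptimal (I : Infostation F) (θ : Fin F → ℝ) (A : Finset (Fin F)) : Prop :=
  I.Feasible A ∧ ∀ B, I.Feasible B → I.reward θ B ≤ I.reward θ A

/-- Optimal single-period reward (a maximum over finitely many cache contents). -/
def optReward (I : Infostation F) (θ : Fin F → ℝ) : ℝ :=
  sSup {x | ∃ A, I.Feasible A ∧ x = I.reward θ A}

/-- The bad arm combinations (for an exact solver): feasible, with less than optimal reward. -/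
def Bad (I : Infostation F) (θ : Fin F → ℝ) (A : Finset (Fin F)) : Prop :=
  I.Feasible A ∧ I.reward θ A < I.optReward θ

/-- `Δ_u`: the optimal reward minus the smallest reward of a bad arm combination. -/
def gapMax (I : Infostation F) (θ : Fin F → ℝ) : ℝ :=
  I.optReward θ - sInf {x | ∃ A, I.Bad θ A ∧ x = I.reward θ A}

/-- `Δ_l`: the optimal reward minus the largest reward of a bad arm combination. -/
def gapMin (I : Infostation F) (θ : Fin F → ℝ) : ℝ :=
  I.optReward θ - sSup {x | ∃ A, I.Bad θ A ∧ x = I.reward θ A}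

/-- `M_u`: the maximal cost of switching between two arm combinations. -/
def maxSwitchCost (I : Infostation F) : ℝ :=
  sSup {x | ∃ A B, I.Feasible A ∧ I.Feasible B ∧ x = I.switchCost A B}

/-- `g` controls the variation of the reward: if two profiles differ by at most `Λ` in every
coordinate, then the rewards of every arm combination differ by at most `g Λ`. -/
def IsRewardModulus (I : Infostation F) (g : ℝ → ℝ) : Prop :=
  ∀ (Λ : ℝ) (θ θ' : Fin F → ℝ) (A : Finset (Fin F)), I.Feasible A →
    (∀ f, |θ f - θ' f| ≤ Λ) → |I.reward θ A - I.reward θ' A| ≤ g Λ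

end Infostation

/-- Period `n_b` of the `b`-th switching (`b ≥ 1`): `n_1 = F + 1` and `n_{b+1} = n_b + Δ(b)`. -/
def switchTime (F : ℕ) (Δ : ℕ → ℕ) (b : ℕ) : ℕ :=
  F + 1 + ∑ j ∈ Finset.Ico 1 b, Δ j

variable {Ω : Type*}

/-- `T_f` after period `t`: how often file `f` was cached during the periods `1, …, t`. -/
def playCount (M : ℕ → Ω → Finset (Fin F)) (t : ℕ) (f : Fin F) (ω : Ω) : ℕ :=
  ((Finset.Icc 1 t).filter (fun i => f ∈ M i ω)).card

/-- Sample mean, after period `t`, of the demands for `f` observed while `f` was cached. -/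
def sampleMean (d : ℕ → Fin F → Ω → ℝ) (M : ℕ → Ω → Finset (Fin F))
    (t : ℕ) (f : Fin F) (ω : Ω) : ℝ :=
  (∑ i ∈ (Finset.Icc 1 t).filter (fun i => f ∈ M i ω), d i f ω) / (playCount M t f ω : ℝ)

/-- The perturbed estimate used in period `t`; it rests on the observations made before `t`. -/
def perturbedMean (d : ℕ → Fin F → Ω → ℝ) (M : ℕ → Ω → Finset (Fin F))
    (t : ℕ) (ω : Ω) (f : Fin F) : ℝ :=
  sampleMean d M (t - 1) f ω +
    Real.sqrt (3 * Real.log (t : ℝ) / (2 * (playCount M (t - 1) f ω : ℝ)))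

variable {mΩ : MeasurableSpace Ω}

/-- The normalised demands `d t f` (`t ≥ 1`): values in `[0,1]`, identically distributed over time
for every file, and the demand vector of each period is independent of everything that happened
before it. The filtration carries the demand history and any internal randomness of the policy.
No independence between the files is required. -/
structure IsIIDDemand (P : Measure Ω) (ℱ : Filtration ℕ mΩ) (d : ℕ → Fin F → Ω → ℝ) :
    Prop where
  adapted : ∀ t f, Measurable[ℱ (t + 1)] (d (t + 1) f)
  indep : ∀ t, Indep (MeasurableSpace.comap (fun ω f => d (t + 1) f ω) MeasurableSpace.pi)
    (ℱ t) P
  identDistrib : ∀ t f, IdentDistrib (d (t + 1) f) (d 1 f) P P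
  bounded : ∀ t f, ∀ᵐ ω ∂P, d (t + 1) f ω ∈ Set.Icc (0 : ℝ) 1

/-- The popularity profile: the vector of the mean demands. -/
def popularity (P : Measure Ω) (d : ℕ → Fin F → Ω → ℝ) (f : Fin F) : ℝ :=
  ∫ ω, d 1 f ω ∂P

/-- The cache contents `M t` are those of a run of the CUCBSC algorithm with an exact solver and
with the lengths `Δ b` between consecutive switching periods. The solver may break ties in any
non-anticipating way, possibly at random. -/
structure IsCUCBSC (I : Infostation F) (P : Measure Ω) (ℱ : Filtration ℕ mΩ)
    (d : ℕ → Fin F → Ω → ℝ) (Δ : ℕ → ℕ) (M : ℕ → Ω → Finset (Fin F)) : Prop where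
  /-- the cache is initially empty -/
  empty : ∀ ω, M 0 ω = ∅
  /-- the content of period `t + 1` is decided on the basis of the history up to period `t` -/
  nonanticipating : ∀ (t : ℕ) (A : Finset (Fin F)), MeasurableSet[ℱ t] {ω | M (t + 1) ω = A}
  /-- initialization, during the first `F` periods: all files are cached at least once -/
  init_feasible : ∀ t ∈ Finset.Icc 1 F, ∀ ω, I.Feasible (M t ω)
  init_all : ∀ (f : Fin F) (ω : Ω), ∃ t ∈ Finset.Icc 1 F, f ∈ M t ω
  /-- switching periods: solve the single-period problem for the perturbed estimates -/
  switching : ∀ b, 1 ≤ b → ∀ᵐ ω ∂P,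
    I.IsOptimal (perturbedMean d M (switchTime F Δ b) ω) (M (switchTime F Δ b) ω)
  /-- non-switching periods: the content is kept -/
  keep : ∀ b, 1 ≤ b → ∀ i < Δ b, ∀ ω,
    M (switchTime F Δ b + i) ω = M (switchTime F Δ b) ω

/-- Sampling-regret up to period `t` (with an exact solver). -/
def samplingRegret (I : Infostation F) (P : Measure Ω) (θ : Fin F → ℝ)
    (M : ℕ → Ω → Finset (Fin F)) (t : ℕ) : ℝ :=
  t * I.optReward θ - ∫ ω, ∑ i ∈ Finset.Icc 1 t, I.reward θ (M i ω) ∂P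

/-- Switching-regret up to period `t`. -/
def switchingRegret (I : Infostation F) (P : Measure Ω)
    (M : ℕ → Ω → Finset (Fin F)) (t : ℕ) : ℝ :=
  ∫ ω, ∑ i ∈ Finset.Icc 1 t, I.switchCost (M i ω) (M (i - 1) ω) ∂P - I.capacity

/-- Regret with switching cost up to period `t`, with weight `w`. -/
def regret (I : Infostation F) (P : Measure Ω) (θ : Fin F → ℝ) (w : ℝ)
    (M : ℕ → Ω → Finset (Fin F)) (t : ℕ) : ℝ :=
  samplingRegret I P θ M t + w * switchingRegret I P M t

end Caching

end

/-! Everything reduces to `badCount`, the number `N` of blocks (of `L` periods each) whose content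
is suboptimal. Write `D = g⁻¹(Δ_l)` and `x = 6 log t / D²`. Deterministically, the sampling regret
is at most `Δ_u (F + L N)` (`sum_gap_le`). Two consecutive optimal blocks share the unique optimum
and cost nothing, so switching costs at most `(F + 1 + 2N) M_u` (`sum_switchCost_le`); since `M_u`
is at most the capacity, subtracting the capacity removes the extra `1`. To bound `N`: if every
sample mean lies within its confidence radius at the start of a block, the perturbed means are
optimistic and exceed the true ones by at most twice the radius. A bad choice then forces some
chosen file to have been observed at most `x` times (`exists_playCount_le`). Each choice of a file
yields `L` observations, so a file takes this blame at most `(x + L - 1) / L` times (`mul_card_le`).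
The confidence intervals fail at period `s` with probability at most `2F/s²`. Because the number of
observations is random and depends on past demands, this comes from an exponential supermartingale
rather than from Hoeffding's inequality for a fixed sample size. Summing over blocks gives the `π²`
term. -/

noncomputable section

namespace Caching

/-! ### Concentration of sample means under adaptive sampling. -/

section Concentration

variable {F : ℕ} {Ω : Type*} {mΩ : MeasurableSpace Ω}

/-- A sum of terms selected by a predictable rule has exponential moment at most one, if each term
is independent of the past and has exponential moment at most one. -/
theorem lintegral_exp_sum_indicator_le_one {P : Measure Ω} [IsProbabilityMeasure P]
    {ℱ : Filtration ℕ mΩ} {X : ℕ → Ω → ℝ} {Q : ℕ → Set Ω}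
    (hX : ∀ t, Measurable[ℱ (t + 1)] (X (t + 1)))
    (hQ : ∀ t, MeasurableSet[ℱ t] (Q (t + 1)))
    (hind : ∀ t, Indep (MeasurableSpace.comap (X (t + 1)) inferInstance) (ℱ t) P)
    (hmgf : ∀ t, ∫⁻ ω, ENNReal.ofReal (Real.exp (X (t + 1) ω)) ∂P ≤ 1) (n : ℕ) :
    Measurable[ℱ n] (fun ω => ENNReal.ofReal
        (Real.exp (∑ i ∈ Finset.Icc 1 n, (Q i).indicator (X i) ω))) ∧
      ∫⁻ ω, ENNReal.ofReal (Real.exp (∑ i ∈ Finset.Icc 1 n, (Q i).indicator (X i) ω)) ∂P ≤ 1 := by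
  induction n with
  | zero => simp
  | succ n ih =>
    obtain ⟨hZ, hle⟩ := ih
    set Z : Ω → ENNReal := fun ω => ENNReal.ofReal
        (Real.exp (∑ i ∈ Finset.Icc 1 n, (Q i).indicator (X i) ω)) with hZdef
    set Y : Ω → ENNReal := fun ω => ENNReal.ofReal (Real.exp (X (n + 1) ω)) with hYdef
    have hQn : MeasurableSet (Q (n + 1)) := ℱ.le n _ (hQ n)
    -- Off `Q (n + 1)` the new factor is `1`; on it, the new factor is independent of `ℱ n`, to
    -- which both `Z` and the selection belong. This is why the induction also carries
    -- measurability.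
    have hsplit : ∀ ω, ENNReal.ofReal
        (Real.exp (∑ i ∈ Finset.Icc 1 (n + 1), (Q i).indicator (X i) ω)) =
          (Q (n + 1))ᶜ.indicator Z ω + Y ω * (Q (n + 1)).indicator Z ω := by
      intro ω
      rw [Finset.sum_Icc_succ_top (by omega), Real.exp_add,
        ENNReal.ofReal_mul (Real.exp_nonneg _)]
      by_cases h : ω ∈ Q (n + 1)
      · simp [h, hZdef, hYdef, mul_comm]
      · simp [h, hZdef]
    have hexp : Measurable fun x : ℝ => ENNReal.ofReal (Real.exp x) := by fun_prop
    have hYcomap : Measurable[MeasurableSpace.comap (X (n + 1)) inferInstance] Y :=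
      hexp.comp (comap_measurable _)
    have hZQ : Measurable[ℱ n] ((Q (n + 1)).indicator Z) := hZ.indicator (hQ n)
    have hZQc : Measurable[ℱ n] ((Q (n + 1))ᶜ.indicator Z) := hZ.indicator (hQ n).compl
    have hYF : Measurable[ℱ (n + 1)] Y := hexp.comp (hX n)
    constructor
    · simp_rw [hsplit]
      have h1 := hZQc.mono (ℱ.mono n.le_succ) le_rfl
      have h2 := hZQ.mono (ℱ.mono n.le_succ) le_rfl
      exact h1.add (hYF.mul h2)
    · simp_rw [hsplit]
      rw [lintegral_add_left (hZQc.mono (ℱ.le n) le_rfl),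
        lintegral_mul_eq_lintegral_mul_lintegral_of_independent_measurableSpace
          (((hX n).mono (ℱ.le _) le_rfl).comap_le) (ℱ.le n) (hind n) hYcomap hZQ]
      calc _ ≤ ∫⁻ ω, (Q (n + 1))ᶜ.indicator Z ω ∂P + 1 * ∫⁻ ω, (Q (n + 1)).indicator Z ω ∂P := by
            gcongr
            exact hmgf n
        _ = ∫⁻ ω, Z ω ∂P := by
            rw [one_mul, lintegral_indicator hQn.compl, lintegral_indicator hQn, add_comm,
              lintegral_add_compl _ hQn]
        _ ≤ 1 := hle

/-- Hoeffding's lemma for the demands. -/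
theorem IsIIDDemand.lintegral_exp_le_one {P : Measure Ω} [IsProbabilityMeasure P]
    {ℱ : Filtration ℕ mΩ} {d : ℕ → Fin F → Ω → ℝ} (hd : IsIIDDemand P ℱ d)
    (f : Fin F) (c : ℝ) (t : ℕ) :
    ∫⁻ ω, ENNReal.ofReal (Real.exp (c * (d (t + 1) f ω - popularity P d f) - c ^ 2 / 8)) ∂P
      ≤ 1 := by
  have hm : Measurable (d (t + 1) f) := (hd.adapted t f).mono (ℱ.le _) le_rfl
  have hsub := hasSubgaussianMGF_of_mem_Icc hm.aemeasurable (hd.bounded t f)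
  have hmean : ∫ ω, d (t + 1) f ω ∂P = popularity P d f := (hd.identDistrib t f).integral_eq
  have hle := hsub.mgf_le c
  have hint := hsub.integrable_exp_mul c
  rw [hmean] at hle hint
  simp_rw [sub_eq_add_neg (c * _), Real.exp_add]
  rw [← ofReal_integral_eq_lintegral_ofReal (hint.mul_const _)
    (ae_of_all _ fun ω => by positivity), integral_mul_const, ← ENNReal.ofReal_one]
  apply ENNReal.ofReal_le_ofReal
  calc _ ≤ Real.exp (((‖(1 : ℝ) - 0‖₊ / 2) ^ 2 : NNReal) * c ^ 2 / 2) *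
        Real.exp (-(c ^ 2 / 8)) := by gcongr; exact hle
    _ = 1 := by
      rw [← Real.exp_add]
      simp
      ring

/-- The exponent of the exponential supermartingale that controls the observed demands for `f`. -/
def deviationExponent (d : ℕ → Fin F → Ω → ℝ) (M : ℕ → Ω → Finset (Fin F)) (θ : Fin F → ℝ)
    (f : Fin F) (c : ℝ) (n : ℕ) (ω : Ω) : ℝ :=
  ∑ i ∈ Finset.Icc 1 n, {ω | f ∈ M i ω}.indicator
    (fun ω => c * (d i f ω - θ f) - c ^ 2 / 8) ω

theorem deviationExponent_eq (d : ℕ → Fin F → Ω → ℝ) (M : ℕ → Ω → Finset (Fin F))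
    (θ : Fin F → ℝ) (f : Fin F) (c : ℝ) (n : ℕ) (ω : Ω) :
    deviationExponent d M θ f c n ω =
      c * (∑ i ∈ (Finset.Icc 1 n).filter (fun i => f ∈ M i ω), d i f ω
        - playCount M n f ω * θ f) - c ^ 2 / 8 * playCount M n f ω := by
  simp only [deviationExponent, Set.indicator_apply, Set.mem_ofPred_eq, playCount]
  rw [← Finset.sum_filter, Finset.sum_sub_distrib, ← Finset.mul_sum, Finset.sum_sub_distrib]
  simp only [Finset.sum_const, nsmul_eq_mul]
  ring

/-- The radius of the confidence interval in period `s` for a file observed `j` times. -/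
def radius (s j : ℕ) : ℝ := Real.sqrt (3 * Real.log (s : ℝ) / (2 * (j : ℝ)))

/-- The event that some sample mean may have left its confidence interval in period `s`. -/
def deviationEvent (d : ℕ → Fin F → Ω → ℝ) (M : ℕ → Ω → Finset (Fin F)) (θ : Fin F → ℝ)
    (s : ℕ) : Set Ω :=
  -- The parameter must be deterministic although the observation count is random, hence a union
  -- over its possible values `j`. The choice `c = 4r` maximises `c r j - c² j / 8`, with maximum `2
  -- j r² = 3 log s`.
  ⋃ f : Fin F, ⋃ j ∈ Finset.Icc 1 (s - 1),
    ({ω | ENNReal.ofReal ((s : ℝ) ^ 3) ≤ ENNReal.ofReal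
        (Real.exp (deviationExponent d M θ f (4 * radius s j) (s - 1) ω))} ∪
      {ω | ENNReal.ofReal ((s : ℝ) ^ 3) ≤ ENNReal.ofReal
        (Real.exp (deviationExponent d M θ f (-(4 * radius s j)) (s - 1) ω))})

theorem playCount_le (M : ℕ → Ω → Finset (Fin F)) (n : ℕ) (f : Fin F) (ω : Ω) :
    playCount M n f ω ≤ n := by
  simpa [playCount] using Finset.card_filter_le (Finset.Icc 1 n) (fun i => f ∈ M i ω)

/-- A deviation beyond the radius `r` makes the exponent with `c = ±4r` at least `4r²j - 2r²j = 3
log s`, where `j` is the actual count; this is what the event excludes. -/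
theorem abs_sampleMean_sub_le {d : ℕ → Fin F → Ω → ℝ} {M : ℕ → Ω → Finset (Fin F)}
    {θ : Fin F → ℝ} {s : ℕ} {ω : Ω} (hs : 1 ≤ s) (hω : ω ∉ deviationEvent d M θ s) (f : Fin F)
    (hf : 1 ≤ playCount M (s - 1) f ω) :
    |sampleMean d M (s - 1) f ω - θ f| ≤ radius s (playCount M (s - 1) f ω) := by
  simp only [deviationEvent, Set.mem_iUnion, Finset.mem_Icc, Set.mem_union, Set.mem_ofPred_eq,
    not_exists, not_or] at hω
  obtain ⟨h1, h2⟩ := hω f _ ⟨hf, playCount_le M (s - 1) f ω⟩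
  rw [deviationExponent_eq] at h1 h2
  rw [sampleMean]
  set j := playCount M (s - 1) f ω
  set W := ∑ i ∈ (Finset.Icc 1 (s - 1)).filter (fun i => f ∈ M i ω), d i f ω
  have hj : (0 : ℝ) < j := by exact_mod_cast hf
  have hs' : (1 : ℝ) ≤ s := by exact_mod_cast hs
  have hlog := Real.log_nonneg hs'
  have hr0 : 0 ≤ radius s j := Real.sqrt_nonneg _
  have hr2 : 2 * j * radius s j ^ 2 = 3 * Real.log s := by
    rw [radius, Real.sq_sqrt (by positivity)]
    field_simp
  have key : ∀ x : ℝ, ¬ ENNReal.ofReal ((s : ℝ) ^ 3) ≤ ENNReal.ofReal (Real.exp x) →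
      x < 3 * Real.log s := by
    intro x hx
    by_contra! hle
    apply hx
    apply ENNReal.ofReal_le_ofReal
    calc (s : ℝ) ^ 3 = Real.exp (3 * Real.log s) := by
          rw [mul_comm, Real.exp_mul, Real.exp_log (by linarith)]
          norm_cast
      _ ≤ _ := Real.exp_le_exp.2 hle
  have h1' := key _ h1
  have h2' := key _ h2
  have hW : W = W / j * j := by field_simp
  set x := W / j
  rw [hW] at h1' h2'
  rw [abs_le]
  constructor
  · by_contra! hlt
    have : radius s j * radius s j * j ≤ radius s j * (θ f - x) * j := by
      gcongr
      linarith
    nlinarith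
  · by_contra! hlt
    have : radius s j * radius s j * j ≤ radius s j * (x - θ f) * j := by
      gcongr
    nlinarith

variable {P : Measure Ω} [IsProbabilityMeasure P] {ℱ : Filtration ℕ mΩ}
  {d : ℕ → Fin F → Ω → ℝ} {M : ℕ → Ω → Finset (Fin F)}

theorem measurable_and_lintegral_exp_deviationExponent_le (hd : IsIIDDemand P ℱ d)
    (hM : ∀ (t : ℕ) (A : Finset (Fin F)), MeasurableSet[ℱ t] {ω | M (t + 1) ω = A})
    (f : Fin F) (c : ℝ) (n : ℕ) :
    Measurable[ℱ n] (fun ω => ENNReal.ofReal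
        (Real.exp (deviationExponent d M (popularity P d) f c n ω))) ∧
      ∫⁻ ω, ENNReal.ofReal
        (Real.exp (deviationExponent d M (popularity P d) f c n ω)) ∂P ≤ 1 := by
  refine lintegral_exp_sum_indicator_le_one
    (X := fun i ω => c * (d i f ω - popularity P d f) - c ^ 2 / 8)
    (Q := fun i => {ω | f ∈ M i ω}) (fun t => ?_) (fun t => ?_) (fun t => ?_)
    (fun t => hd.lintegral_exp_le_one f c t) n
  · have h : Measurable fun x : ℝ => c * (x - popularity P d f) - c ^ 2 / 8 := by fun_prop
    exact h.comp (hd.adapted t f)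
  · have : {ω | f ∈ M (t + 1) ω} =
        ⋃ A ∈ (Finset.univ.filter fun A : Finset (Fin F) => f ∈ A), {ω | M (t + 1) ω = A} := by
      ext ω
      simp
    change MeasurableSet[ℱ t] {ω | f ∈ M (t + 1) ω}
    rw [this]
    exact Finset.measurableSet_biUnion _ fun A _ => hM t A
  -- Only one coordinate of the demand vector enters, so dependence between files is harmless.
  · refine indep_of_indep_of_le_left (hd.indep t) ?_
    have h : Measurable fun x : Fin F → ℝ => c * (x f - popularity P d f) - c ^ 2 / 8 := by
      fun_prop
    exact (h.comp (comap_measurable fun ω f => d (t + 1) f ω)).comap_le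

theorem measurableSet_deviationEvent (hd : IsIIDDemand P ℱ d)
    (hM : ∀ (t : ℕ) (A : Finset (Fin F)), MeasurableSet[ℱ t] {ω | M (t + 1) ω = A}) (s : ℕ) :
    MeasurableSet (deviationEvent d M (popularity P d) s) := by
  have h : ∀ f c, MeasurableSet {ω | ENNReal.ofReal ((s : ℝ) ^ 3) ≤ ENNReal.ofReal
        (Real.exp (deviationExponent d M (popularity P d) f c (s - 1) ω))} := fun f c =>
    measurableSet_le measurable_const
      ((measurable_and_lintegral_exp_deviationExponent_le hd hM f c (s - 1)).1.mono (ℱ.le _) le_rfl)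
  exact MeasurableSet.iUnion fun f => Finset.measurableSet_biUnion _ fun j _ =>
    (h f _).union (h f _)

/-- Markov's inequality gives `s⁻³` for each file, count and sign; there are `2F(s - 1)` such
triples. -/
theorem measureReal_deviationEvent_le (hd : IsIIDDemand P ℱ d)
    (hM : ∀ (t : ℕ) (A : Finset (Fin F)), MeasurableSet[ℱ t] {ω | M (t + 1) ω = A})
    {s : ℕ} (hs : 1 ≤ s) :
    P.real (deviationEvent d M (popularity P d) s) ≤ 2 * F / (s : ℝ) ^ 2 := by
  have hs0 : (0 : ℝ) < s := by exact_mod_cast hs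
  have h : ∀ f c, P.real {ω | ENNReal.ofReal ((s : ℝ) ^ 3) ≤ ENNReal.ofReal
        (Real.exp (deviationExponent d M (popularity P d) f c (s - 1) ω))} ≤ 1 / (s : ℝ) ^ 3 := by
    intro f c
    obtain ⟨hm, hle⟩ := measurable_and_lintegral_exp_deviationExponent_le hd hM f c (s - 1)
    have hpos : (0 : ℝ) < (s : ℝ) ^ 3 := by positivity
    apply ENNReal.toReal_le_of_le_ofReal (by positivity)
    refine (meas_ge_le_lintegral_div (hm.mono (ℱ.le _) le_rfl).aemeasurable
      (ENNReal.ofReal_pos.2 hpos).ne' ENNReal.ofReal_ne_top).trans ?_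
    rw [ENNReal.ofReal_div_of_pos hpos, ENNReal.ofReal_one]
    gcongr
  calc _ ≤ ∑ f : Fin F, ∑ j ∈ Finset.Icc 1 (s - 1), (1 / (s : ℝ) ^ 3 + 1 / (s : ℝ) ^ 3) := by
        refine (measureReal_iUnion_fintype_le _).trans (Finset.sum_le_sum fun f _ => ?_)
        refine (measureReal_biUnion_finset_le _ _).trans (Finset.sum_le_sum fun j _ => ?_)
        exact (measureReal_union_le _ _).trans (add_le_add (h f _) (h f _))
    _ = F * ((s - 1 : ℕ) * (2 / (s : ℝ) ^ 3)) := by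
        simp only [Finset.sum_const, Finset.card_univ, Fintype.card_fin, Nat.card_Icc, nsmul_eq_mul]
        rw [Nat.add_sub_cancel]
        ring
    _ ≤ F * (s * (2 / (s : ℝ) ^ 3)) := by
        gcongr
        omega
    _ = _ := by
        field_simp

end Concentration

/-! ### Deterministic estimates: reward gaps, then counting and costs along a sample path. -/

section Paths

variable {F : ℕ}

namespace Infostation

variable (I : Infostation F) {θ : Fin F → ℝ}

theorem switchCost_nonneg (A B : Finset (Fin F)) : 0 ≤ I.switchCost A B :=
  Finset.sum_nonneg fun f _ => (I.size_pos f).le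

theorem switchCost_self (A : Finset (Fin F)) : I.switchCost A A = 0 := by
  simp [switchCost]

theorem switchCost_le_capacity {A : Finset (Fin F)} (hA : I.Feasible A) (B : Finset (Fin F)) :
    I.switchCost A B ≤ I.capacity :=
  (Finset.sum_le_sum_of_subset_of_nonneg Finset.sdiff_subset
    fun f _ _ => (I.size_pos f).le).trans hA

theorem Feasible.mono {I : Infostation F} {A B : Finset (Fin F)} (hA : I.Feasible A)
    (hB : B ⊆ A) : I.Feasible B :=
  (Finset.sum_le_sum_of_subset_of_nonneg hB fun f _ _ => (I.size_pos f).le).trans hA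

theorem switchCost_le_maxSwitchCost {A B : Finset (Fin F)} (hA : I.Feasible A)
    (hB : I.Feasible B) : I.switchCost A B ≤ I.maxSwitchCost :=
  le_csSup ⟨I.capacity, by rintro x ⟨A, B, hA, -, rfl⟩; exact I.switchCost_le_capacity hA B⟩
    ⟨A, B, hA, hB, rfl⟩

theorem maxSwitchCost_le_capacity (h : I.Feasible ∅) : I.maxSwitchCost ≤ I.capacity :=
  csSup_le ⟨_, ∅, ∅, h, h, rfl⟩
    (by rintro x ⟨A, B, hA, -, rfl⟩; exact I.switchCost_le_capacity hA B)

theorem maxSwitchCost_nonneg (h : I.Feasible ∅) : 0 ≤ I.maxSwitchCost :=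
  (I.switchCost_nonneg ∅ ∅).trans (I.switchCost_le_maxSwitchCost h h)

theorem finite_rewards (θ : Fin F → ℝ) (p : Finset (Fin F) → Prop) :
    {x | ∃ A, p A ∧ x = I.reward θ A}.Finite :=
  (Set.finite_range (I.reward θ)).subset (by rintro x ⟨A, -, rfl⟩; exact ⟨A, rfl⟩)

theorem reward_le_optReward {A : Finset (Fin F)} (hA : I.Feasible A) :
    I.reward θ A ≤ I.optReward θ :=
  le_csSup (I.finite_rewards θ _).bddAbove ⟨A, hA, rfl⟩

theorem IsOptimal.reward_eq {I : Infostation F} {A : Finset (Fin F)} (hA : I.IsOptimal θ A) :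
    I.reward θ A = I.optReward θ :=
  le_antisymm (I.reward_le_optReward hA.1)
    (csSup_le ⟨_, A, hA.1, rfl⟩ (by rintro x ⟨B, hB, rfl⟩; exact hA.2 B hB))

theorem isOptimal_of_not_bad {A : Finset (Fin F)} (hA : I.Feasible A) (h : ¬ I.Bad θ A) :
    I.IsOptimal θ A :=
  ⟨hA, fun _ hB => (I.reward_le_optReward hB).trans (not_lt.1 fun h' => h ⟨hA, h'⟩)⟩

variable {I}

theorem Bad.sub_le_gapMax {A : Finset (Fin F)} (hA : I.Bad θ A) :
    I.optReward θ - I.reward θ A ≤ I.gapMax θ :=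
  sub_le_sub_left (csInf_le (I.finite_rewards θ _).bddBelow ⟨A, hA, rfl⟩) _

theorem Bad.gapMin_le_sub {A : Finset (Fin F)} (hA : I.Bad θ A) :
    I.gapMin θ ≤ I.optReward θ - I.reward θ A :=
  sub_le_sub_left (le_csSup (I.finite_rewards θ _).bddAbove ⟨A, hA, rfl⟩) _

theorem Bad.gapMin_pos {A : Finset (Fin F)} (hA : I.Bad θ A) : 0 < I.gapMin θ := by
  obtain ⟨B, hB, hBe⟩ := Set.Nonempty.csSup_mem (s := {x | ∃ A, I.Bad θ A ∧ x = I.reward θ A})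
    ⟨_, A, hA, rfl⟩ (I.finite_rewards θ _)
  rw [gapMin, hBe]
  exact sub_pos.2 hB.2

theorem Bad.gapMax_pos {A : Finset (Fin F)} (hA : I.Bad θ A) : 0 < I.gapMax θ :=
  hA.gapMin_pos.trans_le (hA.gapMin_le_sub.trans hA.sub_le_gapMax)

/-- If some file can be cached and the optimum is unique, then the empty cache is bad. -/
theorem bad_empty (hθ : ∀ f, 0 ≤ θ f) {f : Fin F} (hf : I.Feasible {f})
    (hunique : ∃! A, I.IsOptimal θ A) : I.Bad θ ∅ := by
  have h0 : I.Feasible ∅ := hf.mono (Finset.empty_subset _)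
  by_contra hbad
  have hopt := I.isOptimal_of_not_bad h0 hbad
  have hf' : I.IsOptimal θ {f} := by
    refine ⟨hf, fun B hB => (hopt.2 B hB).trans ?_⟩
    simpa [reward] using mul_nonneg I.users_pos.le (mul_nonneg (I.size_pos f).le (hθ f))
  simpa using hunique.unique hopt hf'

/-- An invertible linear map could be decreasing; a single cacheable file rules this out. Hence `g`
and its inverse preserve order. -/
theorem IsRewardModulus.map_one_pos {g : ℝ ≃ₗ[ℝ] ℝ} (hg : I.IsRewardModulus g) {f : Fin F}
    (hf : I.Feasible {f}) : 0 < g 1 := by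
  have h := hg 1 (fun _ => 1) (fun _ => 0) {f} hf (by simp)
  have hpos : 0 < I.users * I.size f := mul_pos I.users_pos (I.size_pos f)
  simp only [reward, Finset.sum_singleton, mul_one, mul_zero, sub_zero, abs_of_pos hpos] at h
  exact hpos.trans_le h

theorem linearEquiv_apply (g : ℝ ≃ₗ[ℝ] ℝ) (x : ℝ) : g x = x * g 1 := by
  conv_lhs => rw [← mul_one x, ← smul_eq_mul, map_smul, smul_eq_mul]

theorem linearEquiv_symm_apply (g : ℝ ≃ₗ[ℝ] ℝ) (x : ℝ) : g.symm x * g 1 = x := by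
  rw [← linearEquiv_apply, LinearEquiv.apply_symm_apply]

theorem IsRewardModulus.symm_gapMin_pos {g : ℝ ≃ₗ[ℝ] ℝ} (hg : I.IsRewardModulus g) {f : Fin F}
    (hf : I.Feasible {f}) {A : Finset (Fin F)} (hA : I.Bad θ A) : 0 < g.symm (I.gapMin θ) := by
  have h := linearEquiv_symm_apply g (I.gapMin θ)
  exact pos_of_mul_pos_left (hA.gapMin_pos.trans_eq h.symm) (hg.map_one_pos hf).le

/-- The empty content is bad with reward `0`, so `Δ_l ≤ r_opt`; comparing `θ` with the zero profile
gives `r_opt ≤ g 1`. This serves to make the observation threshold `x` at least `1`. -/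
theorem IsRewardModulus.symm_gapMin_le_one {g : ℝ ≃ₗ[ℝ] ℝ} (hg : I.IsRewardModulus g)
    (hθ : ∀ f, θ f ∈ Set.Icc (0 : ℝ) 1) {f : Fin F} (hf : I.Feasible {f})
    (hunique : ∃! A, I.IsOptimal θ A) : g.symm (I.gapMin θ) ≤ 1 := by
  have hbad := bad_empty (fun f => (hθ f).1) hf hunique
  obtain ⟨A, hA, -⟩ := hunique
  have h1 := hbad.gapMin_le_sub
  have h2 := hg 1 θ (fun _ => 0) A hA.1
    (fun f => by simpa [abs_of_nonneg (hθ f).1] using (hθ f).2)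
  have h3 : I.gapMin θ ≤ g 1 := by
    simp only [reward, Finset.sum_empty, mul_zero, sub_zero, Finset.sum_const_zero] at h1 h2
    rw [← hA.reward_eq] at h1
    exact h1.trans ((le_abs_self _).trans h2)
  have h4 := linearEquiv_symm_apply g (I.gapMin θ)
  exact le_of_mul_le_mul_right (by linarith) (hg.map_one_pos hf)

/-- If optimistic estimates on a bad cache content are close to the true means, then that content
is not optimal for them. -/
theorem IsRewardModulus.exists_gap_le {g : ℝ ≃ₗ[ℝ] ℝ} (hg : I.IsRewardModulus g)
    {A B : Finset (Fin F)} {ν : Fin F → ℝ} {Λ : ℝ} (hΛ : 0 ≤ Λ) (hA : I.Bad θ A)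
    (hAν : I.IsOptimal ν A) (hB : I.IsOptimal θ B) (hopt : ∀ f, θ f ≤ ν f)
    (hclose : ∀ f ∈ A, ν f ≤ θ f + Λ) {f : Fin F} (hf : I.Feasible {f}) :
    g.symm (I.gapMin θ) ≤ Λ := by
  classical
  -- The modulus needs closeness in every coordinate, so `ν` is reset to `θ` off `A`, which the
  -- reward of `A` does not see. Then `r_θ(B) ≤ r_ν(B) ≤ r_ν(A) ≤ r_θ(A) + g Λ`.
  have hmod := hg Λ (fun f => if f ∈ A then ν f else θ f) θ A hA.1 (fun f => by
    by_cases h : f ∈ A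
    · simp only [h, if_true]
      rw [abs_le]
      constructor <;> linarith [hopt f, hclose f h]
    · simpa [h] using hΛ)
  have heq : I.reward (fun f => if f ∈ A then ν f else θ f) A = I.reward ν A := by
    simp only [reward]
    congr 1
    exact Finset.sum_congr rfl fun f hf => by simp [hf]
  rw [heq] at hmod
  have h1 : I.reward θ B ≤ I.reward ν B :=
    mul_le_mul_of_nonneg_left (Finset.sum_le_sum fun f _ =>
      mul_le_mul_of_nonneg_left (hopt f) (I.size_pos f).le) I.users_pos.le
  have h2 := hAν.2 B hB.1
  have h3 := hA.gapMin_le_sub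
  rw [← hB.reward_eq] at h3
  rw [linearEquiv_apply] at hmod
  have h4 := linearEquiv_symm_apply g (I.gapMin θ)
  exact le_of_mul_le_mul_right (by linarith [le_abs_self (I.reward ν A - I.reward θ A)])
    (hg.map_one_pos hf)

end Infostation

theorem switchTime_const (L : ℕ) (b : ℕ) :
    switchTime F (fun _ => L) b = F + 1 + (b - 1) * L := by
  simp [switchTime]

/-- From here on blocks are numbered from `0`: block `b` starts in period `F + b * L + 1`, with `F +
b * L` periods before it. -/
theorem switchTime_succ (L b : ℕ) : switchTime F (fun _ => L) (b + 1) = F + b * L + 1 := by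
  rw [switchTime_const, Nat.add_sub_cancel]
  omega

variable {Ω : Type*}

theorem sum_Icc_add {β : Type*} [AddCommMonoid β] (x : ℕ → β) (n L : ℕ) :
    ∑ i ∈ Finset.Icc 1 (n + L), x i = ∑ i ∈ Finset.Icc 1 n, x i +
      ∑ j ∈ Finset.range L, x (n + 1 + j) := by
  induction L with
  | zero => simp
  | succ L ih =>
    rw [← add_assoc, Finset.sum_Icc_succ_top (by omega), ih, Finset.sum_range_succ, add_assoc,
      Nat.add_right_comm n 1 L]

theorem playCount_eq_sum (M : ℕ → Ω → Finset (Fin F)) (t : ℕ) (f : Fin F) (ω : Ω) :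
    playCount M t f ω = ∑ i ∈ Finset.Icc 1 t, if f ∈ M i ω then 1 else 0 := by
  rw [playCount, Finset.card_filter]

/-- Along a sample path on which every content chosen at a switching period is kept for `L` periods,
a file is observed `L` times for each earlier block whose content contains it. -/
theorem one_add_mul_card_le_playCount {M : ℕ → Ω → Finset (Fin F)} {L : ℕ} {ω : Ω}
    (hinit : ∀ f, ∃ t ∈ Finset.Icc 1 F, f ∈ M t ω)
    (hkeep : ∀ b, ∀ i < L, M (F + b * L + 1 + i) ω = M (F + b * L + 1) ω) (f : Fin F) (b : ℕ) :
    1 + L * ((Finset.range b).filter fun c => f ∈ M (F + c * L + 1) ω).card ≤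
      playCount M (F + b * L) f ω := by
  induction b with
  | zero =>
    obtain ⟨t, ht, hf⟩ := hinit f
    simpa [playCount] using ⟨t, Finset.mem_filter.2 ⟨ht, hf⟩⟩
  | succ b ih =>
    rw [Nat.succ_mul, ← add_assoc, playCount_eq_sum, sum_Icc_add, ← playCount_eq_sum,
      Finset.range_add_one, Finset.filter_insert,
      Finset.sum_congr rfl fun j hj => by rw [hkeep b j (Finset.mem_range.1 hj)]]
    split_ifs with h
    · rw [Finset.card_insert_of_notMem (by simp)]
      simp
      linarith
    · simpa using ih

/-- A file belongs to at most `(x + L - 1) / L` of the contents chosen when it was observed at most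
`x` times, or in the first block. -/
theorem mul_card_le {M : ℕ → Ω → Finset (Fin F)} {L : ℕ} {ω : Ω}
    (hinit : ∀ f, ∃ t ∈ Finset.Icc 1 F, f ∈ M t ω)
    (hkeep : ∀ b, ∀ i < L, M (F + b * L + 1 + i) ω = M (F + b * L + 1) ω) (f : Fin F) (B : ℕ)
    {x : ℝ} (hx : 0 ≤ x) (hL : 1 ≤ L) (hx1 : B ≠ 0 → 1 ≤ x) {C : Finset ℕ}
    (hCB : C ⊆ Finset.range B)
    (hC : ∀ b ∈ C, f ∈ M (F + b * L + 1) ω ∧ (b = 0 ∨ (playCount M (F + b * L) f ω : ℝ) ≤ x)) :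
    L * (C.card : ℝ) ≤ x + L - 1 := by
  have hL' : (1 : ℝ) ≤ L := by exact_mod_cast hL
  rcases C.eq_empty_or_nonempty with rfl | hne
  · simp
    linarith
  -- At the last block `m` of `C`, the others have each contributed `L` observations and
  -- initialization one more, so `1 + L (|C| - 1) ≤ x`. If `m = 0`, then `|C| = 1` and `1 ≤ x`
  -- suffices.
  have hm := C.max'_mem hne
  set m := C.max' hne with hmdef
  have hB : B ≠ 0 := by
    have := Finset.mem_range.1 (hCB hm)
    omega
  have hsub : C.erase m ⊆ (Finset.range m).filter fun c => f ∈ M (F + c * L + 1) ω := by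
    intro c hc
    obtain ⟨hcm, hcC⟩ := Finset.mem_erase.1 hc
    exact Finset.mem_filter.2 ⟨Finset.mem_range.2 (lt_of_le_of_ne (C.le_max' c hcC) hcm),
      (hC c hcC).1⟩
  have hcard := Finset.card_le_card hsub
  rw [Finset.card_erase_of_mem hm] at hcard
  have hpos := hne.card_pos
  have hcard' : (C.card : ℝ) ≤
      ((Finset.range m).filter fun c => f ∈ M (F + c * L + 1) ω).card + 1 := by
    exact_mod_cast (by omega)
  have hplay : 1 + (L : ℝ) * ((Finset.range m).filter fun c => f ∈ M (F + c * L + 1) ω).card ≤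
      playCount M (F + m * L) f ω := by
    exact_mod_cast one_add_mul_card_le_playCount hinit hkeep f m
  rcases (hC m hm).2 with h0 | hle
  · rw [h0] at hcard'
    simp only [Finset.range_zero, Finset.filter_empty, Finset.card_empty, Nat.cast_zero] at hcard'
    nlinarith [hx1 hB]
  · nlinarith

open Classical in
/-- Number of bad contents among those chosen at the first `B` switching periods. -/
def badCount (I : Infostation F) (θ : Fin F → ℝ) (M : ℕ → Ω → Finset (Fin F)) (L B : ℕ)
    (ω : Ω) : ℝ :=
  ∑ b ∈ Finset.range B, if I.Bad θ (M (F + b * L + 1) ω) then 1 else 0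

theorem sum_switchCost_block {M : ℕ → Ω → Finset (Fin F)} {L : ℕ} (hL : 1 ≤ L) {ω : Ω}
    (hkeep : ∀ b, ∀ i < L, M (F + b * L + 1 + i) ω = M (F + b * L + 1) ω)
    (I : Infostation F) (b : ℕ) :
    ∑ j ∈ Finset.range L, I.switchCost (M (F + b * L + 1 + j) ω) (M (F + b * L + 1 + j - 1) ω) =
      I.switchCost (M (F + b * L + 1) ω) (M (F + b * L) ω) := by
  rw [Finset.sum_eq_single_of_mem 0 (Finset.mem_range.2 hL)]
  · simp
  · intro j hj hj0
    rw [Finset.mem_range] at hj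
    obtain ⟨k, rfl⟩ := Nat.exists_eq_succ_of_ne_zero hj0
    rw [hkeep b _ hj, Nat.succ_eq_add_one, ← add_assoc, Nat.add_sub_cancel,
      hkeep b k (by omega), I.switchCost_self]

/-- Pathwise bound of the sampling regret. -/
theorem sum_gap_le {I : Infostation F} {θ : Fin F → ℝ} {M : ℕ → Ω → Finset (Fin F)} {L : ℕ}
    {ω : Ω} (hfeas : ∀ i, 1 ≤ i → I.Feasible (M i ω)) (hgap : 0 ≤ I.gapMax θ)
    (hkeep : ∀ b, ∀ i < L, M (F + b * L + 1 + i) ω = M (F + b * L + 1) ω) (B : ℕ) :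
    ∑ i ∈ Finset.Icc 1 (F + B * L), (I.optReward θ - I.reward θ (M i ω)) ≤
      I.gapMax θ * (F + L * badCount I θ M L B ω) := by
  classical
  induction B with
  | zero =>
    simp only [zero_mul, add_zero, badCount, Finset.range_zero, Finset.sum_empty, mul_zero]
    calc _ ≤ ∑ i ∈ Finset.Icc 1 F, I.gapMax θ := by
          refine Finset.sum_le_sum fun i hi => ?_
          by_cases h : I.Bad θ (M i ω)
          · exact h.sub_le_gapMax
          · have := (I.isOptimal_of_not_bad (hfeas i (Finset.mem_Icc.1 hi).1) h).reward_eq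
            linarith
      _ = _ := by simp [mul_comm]
  | succ B ih =>
    have hblock : ∑ j ∈ Finset.range L, (I.optReward θ - I.reward θ (M (F + B * L + 1 + j) ω)) =
        L * (I.optReward θ - I.reward θ (M (F + B * L + 1) ω)) := by
      rw [Finset.sum_congr rfl fun j hj => by rw [hkeep B j (Finset.mem_range.1 hj)]]
      simp [mul_sub]
    rw [Nat.succ_mul, ← add_assoc, sum_Icc_add, hblock, badCount, Finset.sum_range_succ, ← badCount]
    have : I.optReward θ - I.reward θ (M (F + B * L + 1) ω) ≤
        I.gapMax θ * if I.Bad θ (M (F + B * L + 1) ω) then 1 else 0 := by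
      split_ifs with h
      · simpa using h.sub_le_gapMax
      · have := (I.isOptimal_of_not_bad (hfeas _ (by omega)) h).reward_eq
        linarith
    have := mul_le_mul_of_nonneg_left this (Nat.cast_nonneg (α := ℝ) L)
    linarith

/-- Pathwise bound of the switching costs. -/
theorem sum_switchCost_le {I : Infostation F} {θ : Fin F → ℝ} {M : ℕ → Ω → Finset (Fin F)} {L : ℕ}
    (hL : 1 ≤ L) {ω : Ω} (hfeas : ∀ i, I.Feasible (M i ω)) (hunique : ∃! A, I.IsOptimal θ A)
    (hkeep : ∀ b, ∀ i < L, M (F + b * L + 1 + i) ω = M (F + b * L + 1) ω) (B : ℕ) :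
    ∑ i ∈ Finset.Icc 1 (F + B * L), I.switchCost (M i ω) (M (i - 1) ω) ≤
      (F + 1 + 2 * badCount I θ M L B ω) * I.maxSwitchCost := by
  classical
  have hcost : ∀ i j, I.switchCost (M i ω) (M j ω) ≤ I.maxSwitchCost := fun i j =>
    I.switchCost_le_maxSwitchCost (hfeas i) (hfeas j)
  have h0 : 0 ≤ I.maxSwitchCost := (I.switchCost_nonneg _ _).trans (hcost 0 0)
  have hinit : ∑ i ∈ Finset.Icc 1 F, I.switchCost (M i ω) (M (i - 1) ω) ≤
      F * I.maxSwitchCost := by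
    simpa using Finset.sum_le_card_nsmul (Finset.Icc 1 F) _ _ fun i _ => hcost i (i - 1)
  let β : ℕ → ℝ := fun b => if I.Bad θ (M (F + b * L + 1) ω) then 1 else 0
  have hβ : ∀ b, 0 ≤ β b := fun b => by simp only [β]; split_ifs <;> norm_num
  have hsucc : ∀ b, badCount I θ M L (b + 1) ω = badCount I θ M L b ω + β b := fun b =>
    Finset.sum_range_succ _ _
  -- A bad block pays for the switch into it and the switch out of it. The extra `β b` on the left
  -- keeps the second payment in reserve for the next switch.
  have hstrong : ∀ b, ∑ i ∈ Finset.Icc 1 (F + (b + 1) * L), I.switchCost (M i ω) (M (i - 1) ω) +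
      β b * I.maxSwitchCost ≤ (F + 1 + 2 * badCount I θ M L (b + 1) ω) * I.maxSwitchCost := by
    intro b
    rw [Nat.succ_mul, ← add_assoc, sum_Icc_add, sum_switchCost_block hL hkeep, hsucc]
    induction b with
    | zero =>
      have h1 := hcost (F + 0 * L + 1) (F + 0 * L)
      have h2 := mul_nonneg (hβ 0) h0
      simp only [zero_mul, add_zero, badCount, Finset.range_zero, Finset.sum_empty] at h1 ⊢
      linarith
    | succ b ih =>
      rw [Nat.succ_mul, ← add_assoc, sum_Icc_add, sum_switchCost_block hL hkeep, hsucc]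
      have hprev : M (F + b * L + L) ω = M (F + b * L + 1) ω := by
        rw [← hkeep b (L - 1) (by omega)]
        congr 1
        omega
      have hc : I.switchCost (M (F + b * L + L + 1) ω) (M (F + b * L + L) ω) ≤
          (β b + β (b + 1)) * I.maxSwitchCost := by
        by_cases hb : I.Bad θ (M (F + b * L + 1) ω)
        · have : β b = 1 := if_pos hb
          nlinarith [hcost (F + b * L + L + 1) (F + b * L + L), hβ (b + 1)]
        by_cases hb' : I.Bad θ (M (F + (b + 1) * L + 1) ω)
        · have : β (b + 1) = 1 := if_pos hb'
          nlinarith [hcost (F + b * L + L + 1) (F + b * L + L), hβ b]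
        rw [Nat.succ_mul, ← add_assoc] at hb'
        rw [hprev, hunique.unique (I.isOptimal_of_not_bad (hfeas _) hb)
          (I.isOptimal_of_not_bad (hfeas _) hb'), I.switchCost_self]
        exact mul_nonneg (add_nonneg (hβ _) (hβ _)) h0
      linarith
  cases B with
  | zero =>
    simp only [zero_mul, add_zero, badCount, Finset.range_zero, Finset.sum_empty, mul_zero]
    linarith
  | succ b => linarith [hstrong b, mul_nonneg (hβ b) h0]

/-- A content chosen by optimistic estimates within their confidence intervals, but bad, contains
a file that has not been observed often. -/
theorem exists_playCount_le {I : Infostation F} {θ : Fin F → ℝ} {d : ℕ → Fin F → Ω → ℝ}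
    {M : ℕ → Ω → Finset (Fin F)} {g : ℝ ≃ₗ[ℝ] ℝ} (hg : I.IsRewardModulus g)
    (hunique : ∃! A, I.IsOptimal θ A) {f₀ : Fin F} (hf₀ : I.Feasible {f₀}) {s : ℕ} {ω : Ω}
    (hs : 1 ≤ s) (hplay : ∀ f, 1 ≤ playCount M (s - 1) f ω)
    (hopt : I.IsOptimal (perturbedMean d M s ω) (M s ω)) (hbad : I.Bad θ (M s ω))
    (hω : ω ∉ deviationEvent d M θ s) :
    ∃ f ∈ M s ω, (playCount M (s - 1) f ω : ℝ) ≤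
      6 * Real.log s / g.symm (I.gapMin θ) ^ 2 := by
  by_contra! hcon
  have hD := hg.symm_gapMin_pos hf₀ hbad
  set D := g.symm (I.gapMin θ) with hDdef
  have hlog : 0 ≤ Real.log s := Real.log_nonneg (by exact_mod_cast hs)
  have habs := fun f => abs_le.1 (abs_sampleMean_sub_le hs hω f (hplay f))
  have hpert : ∀ f, perturbedMean d M s ω f =
    sampleMean d M (s - 1) f ω + radius s (playCount M (s - 1) f ω) := fun f => rfl
  -- The threshold `6 log s / D²` is exactly where twice the radius equals `D`.
  have hrad : ∀ f ∈ M s ω, 2 * radius s (playCount M (s - 1) f ω) < D := by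
    intro f hf
    have h := hcon f hf
    have hj : (0 : ℝ) < playCount M (s - 1) f ω := by exact_mod_cast hplay f
    rw [div_lt_iff₀ (by positivity)] at h
    have : radius s (playCount M (s - 1) f ω) < D / 2 := by
      rw [radius, Real.sqrt_lt' (by positivity), div_lt_iff₀ (by positivity)]
      nlinarith
    linarith
  obtain ⟨Λ, hΛ0, hΛD, hΛ⟩ : ∃ Λ, 0 ≤ Λ ∧ Λ < D ∧
      ∀ f ∈ M s ω, 2 * radius s (playCount M (s - 1) f ω) ≤ Λ := by
    rcases (M s ω).eq_empty_or_nonempty with h | h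
    · exact ⟨0, le_rfl, hD, by simp [h]⟩
    · obtain ⟨f, hf, hmax⟩ := Finset.exists_max_image _
        (fun f => 2 * radius s (playCount M (s - 1) f ω)) h
      exact ⟨_, mul_nonneg zero_le_two (Real.sqrt_nonneg _), hrad f hf, hmax⟩
  obtain ⟨B, hB, -⟩ := hunique
  refine hΛD.not_ge (hg.exists_gap_le hΛ0 hbad hopt hB (fun f => ?_) (fun f hf => ?_) hf₀)
  · rw [hpert]
    linarith [(habs f).1]
  · rw [hpert]
    linarith [(habs f).2, hΛ f hf]

end Paths

/-! ### Expected number of bad blocks. -/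

section Regret

variable {F : ℕ} {Ω : Type*} {mΩ : MeasurableSpace Ω} {P : Measure Ω}
  {ℱ : Filtration ℕ mΩ} {d : ℕ → Fin F → Ω → ℝ} {M : ℕ → Ω → Finset (Fin F)}
  {I : Infostation F} {θ : Fin F → ℝ} {L : ℕ}

theorem sum_one_div_sq_le (hL : 1 ≤ L) (B : ℕ) :
    ∑ b ∈ Finset.Ico 1 B, 2 * (F : ℝ) / ((F + b * L + 1 : ℕ) : ℝ) ^ 2 ≤
      F * (Real.pi ^ 2 / (3 * L)) / L := by
  have hL' : (0 : ℝ) < L := by exact_mod_cast hL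
  calc _ ≤ ∑ b ∈ Finset.Ico 1 B, 2 * (F : ℝ) / (L : ℝ) ^ 2 * (1 / (b : ℝ) ^ 2) := by
        refine Finset.sum_le_sum fun b hb => ?_
        have hb' : (0 : ℝ) < b := by exact_mod_cast (Finset.mem_Ico.1 hb).1
        rw [div_mul_div_comm, mul_one, ← mul_pow]
        gcongr
        push_cast
        nlinarith [Nat.cast_nonneg (α := ℝ) F]
    _ ≤ 2 * (F : ℝ) / (L : ℝ) ^ 2 * (Real.pi ^ 2 / 6) := by
        rw [← Finset.mul_sum]
        gcongr
        exact sum_le_hasSum _ (fun i _ => by positivity) hasSum_zeta_two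
    _ = _ := by
        field_simp
        ring

namespace IsCUCBSC

theorem keep_block (hM : IsCUCBSC I P ℱ d (fun _ => L) M) (ω : Ω) (b : ℕ) (i : ℕ) (hi : i < L) :
    M (F + b * L + 1 + i) ω = M (F + b * L + 1) ω := by
  have := hM.keep (b + 1) (by omega) i hi ω
  rwa [switchTime_succ] at this

theorem switching_block (hM : IsCUCBSC I P ℱ d (fun _ => L) M) :
    ∀ᵐ ω ∂P, ∀ b, I.IsOptimal (perturbedMean d M (F + b * L + 1) ω) (M (F + b * L + 1) ω) := by
  rw [ae_all_iff]
  intro b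
  have := hM.switching (b + 1) (by omega)
  rwa [switchTime_succ] at this

theorem feasible (hM : IsCUCBSC I P ℱ d (fun _ => L) M) (hL : 1 ≤ L) (h0 : I.Feasible ∅) :
    ∀ᵐ ω ∂P, ∀ i, I.Feasible (M i ω) := by
  filter_upwards [hM.switching_block] with ω hω i
  rcases Nat.eq_zero_or_pos i with rfl | hi
  · rwa [hM.empty]
  rcases le_or_gt i F with hiF | hiF
  · exact hM.init_feasible i (Finset.mem_Icc.2 ⟨hi, hiF⟩) ω
  · have hdiv := Nat.div_add_mod' (i - (F + 1)) L
    have hmod := Nat.mod_lt (i - (F + 1)) (by omega : 0 < L)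
    have hi' : i = F + (i - (F + 1)) / L * L + 1 + (i - (F + 1)) % L := by omega
    rw [hi', hM.keep_block ω _ _ hmod]
    exact (hω _).1

theorem one_le_playCount (hM : IsCUCBSC I P ℱ d (fun _ => L) M) (f : Fin F) (ω : Ω) (n : ℕ) :
    1 ≤ playCount M (F + n) f ω := by
  obtain ⟨t, ht, hf⟩ := hM.init_all f ω
  obtain ⟨h1, h2⟩ := Finset.mem_Icc.1 ht
  exact Finset.card_pos.2 ⟨t, Finset.mem_filter.2 ⟨Finset.mem_Icc.2 ⟨h1, by omega⟩, hf⟩⟩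

theorem measurable_content (hM : IsCUCBSC I P ℱ d (fun _ => L) M) (t : ℕ) :
    Measurable[mΩ, ⊤] (M t) := by
  let _ : MeasurableSpace (Finset (Fin F)) := ⊤
  refine measurable_to_countable' fun A => ?_
  cases t with
  | zero =>
    have : M 0 = fun _ => ∅ := funext hM.empty
    rw [this]
    exact measurable_const (measurableSet_singleton A)
  | succ t => exact ℱ.le t _ (hM.nonanticipating t A)

end IsCUCBSC

variable [IsProbabilityMeasure P]

theorem IsIIDDemand.popularity_mem_Icc (hd : IsIIDDemand P ℱ d) (f : Fin F) :
    popularity P d f ∈ Set.Icc (0 : ℝ) 1 := by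
  have hb := hd.bounded 0 f
  have hm : Measurable (d (0 + 1) f) := (hd.adapted 0 f).mono (ℱ.le _) le_rfl
  constructor
  · exact integral_nonneg_of_ae (hb.mono fun ω h => h.1)
  · have := integral_mono_ae (Integrable.of_mem_Icc 0 1 hm.aemeasurable hb)
      (integrable_const (1 : ℝ)) (hb.mono fun ω h => h.2)
    simpa [popularity] using this

namespace IsCUCBSC

theorem feasible_singleton (hM : IsCUCBSC I P ℱ d (fun _ => L) M) (f : Fin F) :
    I.Feasible {f} := by
  obtain ⟨ω⟩ : Nonempty Ω := nonempty_of_isProbabilityMeasure P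
  obtain ⟨t, ht, hf⟩ := hM.init_all f ω
  exact (hM.init_feasible t ht ω).mono (by simpa using hf)

/-- The first content chosen by the solver is nonempty, because all estimates are positive. -/
theorem nonempty_first (hM : IsCUCBSC I P ℱ d (fun _ => L) M) (hd : IsIIDDemand P ℱ d)
    (f : Fin F) : ∀ᵐ ω ∂P, (M (F + 1) ω).Nonempty := by
  have hb : ∀ᵐ ω ∂P, ∀ t f, d (t + 1) f ω ∈ Set.Icc (0 : ℝ) 1 := by
    simp_rw [ae_all_iff]
    exact hd.bounded
  filter_upwards [hM.switching_block, hb] with ω hω hbω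
  by_contra hne
  rw [Finset.not_nonempty_iff_eq_empty] at hne
  have h := (hω 0).2 {f} (hM.feasible_singleton f)
  simp only [zero_mul, add_zero, hne, Infostation.reward, Finset.sum_empty, mul_zero,
    Finset.sum_singleton] at h
  refine h.not_gt (mul_pos I.users_pos (mul_pos (I.size_pos f) ?_))
  have hj : (0 : ℝ) < playCount M F f ω := by exact_mod_cast hM.one_le_playCount f ω 0
  have hF : (1 : ℝ) < (F + 1 : ℕ) := by
    exact_mod_cast Nat.lt_add_of_pos_left (Fin.pos f)
  have hlog := Real.log_pos hF
  refine add_pos_of_nonneg_of_pos (div_nonneg (Finset.sum_nonneg fun i hi => ?_)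
    (Nat.cast_nonneg _)) (Real.sqrt_pos.2 ?_)
  · obtain ⟨hi1, -⟩ := Finset.mem_Icc.1 (Finset.mem_filter.1 hi).1
    obtain ⟨k, rfl⟩ := Nat.exists_eq_add_of_le' hi1
    exact (hbω k f).1
  · rw [Nat.add_sub_cancel]
    positivity

/-- There are only finitely many contents, so any function of them is bounded. -/
theorem integrable_comp (hM : IsCUCBSC I P ℱ d (fun _ => L) M)
    (h : Finset (Fin F) → Finset (Fin F) → ℝ) (s t : ℕ) :
    Integrable (fun ω => h (M s ω) (M t ω)) P := by
  let _ : MeasurableSpace (Finset (Fin F)) := ⊤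
  have hm : Measurable fun ω => (M s ω, M t ω) :=
    (hM.measurable_content s).prodMk (hM.measurable_content t)
  have hh : Measurable fun p : Finset (Fin F) × Finset (Fin F) => h p.1 p.2 :=
    measurable_of_countable _
  obtain ⟨C, hC⟩ := (Set.finite_range
    fun p : Finset (Fin F) × Finset (Fin F) => ‖h p.1 p.2‖).bddAbove
  exact Integrable.of_bound (hh.comp hm).aestronglyMeasurable C
    (ae_of_all _ fun ω => hC ⟨(M s ω, M t ω), rfl⟩)

theorem integrable_badCount (hM : IsCUCBSC I P ℱ d (fun _ => L) M) (B : ℕ) :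
    Integrable (badCount I θ M L B) P := by
  classical
  exact integrable_finsetSum _ fun b _ =>
    hM.integrable_comp (fun A _ => if I.Bad θ A then 1 else 0) (F + b * L + 1) 0

/-- Pathwise bound of the number of bad contents chosen at the first `B` switching periods. -/
theorem badCount_le (hM : IsCUCBSC I P ℱ d (fun _ => L) M) (hd : IsIIDDemand P ℱ d)
    (hF : 1 ≤ F) (hL : 1 ≤ L) (hunique : ∃! A, I.IsOptimal θ A) {g : ℝ ≃ₗ[ℝ] ℝ}
    (hg : I.IsRewardModulus g) {B : ℕ} {x : ℝ} (hx : 0 ≤ x) (hx1 : B ≠ 0 → 1 ≤ x)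
    (hlog : ∀ b < B, 6 * Real.log (F + b * L + 1 : ℕ) / g.symm (I.gapMin θ) ^ 2 ≤ x) :
    ∀ᵐ ω ∂P, badCount I θ M L B ω ≤ F * ((x + L - 1) / L) +
      ∑ b ∈ Finset.Ico 1 B, (deviationEvent d M θ (F + b * L + 1)).indicator 1 ω := by
  classical
  filter_upwards [hM.switching_block, hM.nonempty_first hd ⟨0, hF⟩] with ω hω hne
  let C : Fin F → Finset ℕ := fun f => (Finset.range B).filter fun b =>
    f ∈ M (F + b * L + 1) ω ∧ (b = 0 ∨ (playCount M (F + b * L) f ω : ℝ) ≤ x)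
  have hCle : ∀ f, ((C f).card : ℝ) ≤ (x + L - 1) / L := by
    intro f
    rw [le_div_iff₀ (by exact_mod_cast hL), mul_comm]
    exact mul_card_le (fun f => hM.init_all f ω) (hM.keep_block ω) f B hx hL hx1
      (Finset.filter_subset _ _) fun b hb => (Finset.mem_filter.1 hb).2
  have hsub : (Finset.range B).filter (fun b => I.Bad θ (M (F + b * L + 1) ω)) ⊆
      Finset.univ.biUnion C ∪
        (Finset.Ico 1 B).filter fun b => ω ∈ deviationEvent d M θ (F + b * L + 1) := by
    intro b hb
    obtain ⟨hbB, hbad⟩ := Finset.mem_filter.1 hb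
    have hbB' := Finset.mem_range.1 hbB
    simp only [Finset.mem_union, Finset.mem_biUnion, Finset.mem_univ, true_and,
      Finset.mem_filter, Finset.mem_Ico, C]
    -- Block `0` is charged to any file of its nonempty content, without using confidence intervals.
    -- So deviation events are needed only for `b ≥ 1`, where `F + b * L + 1 ≥ b * L` allows
    -- comparison with `ζ(2)`.
    rcases Nat.eq_zero_or_pos b with rfl | hb0
    · left
      obtain ⟨f, hf⟩ := hne
      exact ⟨f, hbB, by simpa using hf, Or.inl rfl⟩
    by_cases hdev : ω ∈ deviationEvent d M θ (F + b * L + 1)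
    · exact Or.inr ⟨⟨hb0, hbB'⟩, hdev⟩
    · left
      obtain ⟨f, hf, hle⟩ := exists_playCount_le hg hunique
        (hM.feasible_singleton ⟨0, hF⟩) (by omega)
        (fun f => hM.one_le_playCount f ω (b * L)) (hω b) hbad hdev
      exact ⟨f, hbB, hf, Or.inr (hle.trans (hlog b hbB'))⟩
  have hcard := (Finset.card_le_card hsub).trans (Finset.card_union_le _ _)
  have hcard' := hcard.trans (Nat.add_le_add_right Finset.card_biUnion_le _)
  have hreal : badCount I θ M L B ω =
      ((Finset.range B).filter (fun b => I.Bad θ (M (F + b * L + 1) ω))).card := by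
    rw [badCount, Finset.sum_boole]
  have hind : ∑ b ∈ Finset.Ico 1 B,
      (deviationEvent d M θ (F + b * L + 1)).indicator (1 : Ω → ℝ) ω =
      ((Finset.Ico 1 B).filter fun b => ω ∈ deviationEvent d M θ (F + b * L + 1)).card := by
    simp only [Set.indicator_apply, Pi.one_apply, Finset.sum_boole]
  rw [hreal, hind]
  calc _ ≤ (∑ f, ((C f).card : ℝ)) +
        ((Finset.Ico 1 B).filter fun b => ω ∈ deviationEvent d M θ (F + b * L + 1)).card := by
        exact_mod_cast hcard'
    _ ≤ _ := by
      gcongr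
      simpa using Finset.sum_le_card_nsmul Finset.univ _ _ fun f _ => hCle f

theorem integral_badCount_le (hM : IsCUCBSC I P ℱ d (fun _ => L) M) (hd : IsIIDDemand P ℱ d)
    (hF : 1 ≤ F) (hL : 1 ≤ L) (hunique : ∃! A, I.IsOptimal (popularity P d) A) {g : ℝ ≃ₗ[ℝ] ℝ}
    (hg : I.IsRewardModulus g) {B : ℕ} {x : ℝ} (hx : 0 ≤ x) (hx1 : B ≠ 0 → 1 ≤ x)
    (hlog : ∀ b < B,
      6 * Real.log (F + b * L + 1 : ℕ) / g.symm (I.gapMin (popularity P d)) ^ 2 ≤ x) :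
    ∫ ω, badCount I (popularity P d) M L B ω ∂P ≤
      F * (x + L - 1 + Real.pi ^ 2 / (3 * L)) / L := by
  have hmeas := fun b => measurableSet_deviationEvent hd hM.nonanticipating (F + b * L + 1)
  have hint : ∀ b ∈ Finset.Ico 1 B, Integrable (fun ω =>
      (deviationEvent d M (popularity P d) (F + b * L + 1)).indicator (1 : Ω → ℝ) ω) P :=
    fun b _ => (integrable_const 1).indicator (hmeas b)
  refine (integral_mono_ae (hM.integrable_badCount B)
    ((integrable_const _).add (integrable_finsetSum _ hint))
    (hM.badCount_le hd hF hL hunique hg hx hx1 hlog)).trans ?_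
  simp only [Pi.add_apply]
  rw [integral_add (integrable_const _) (integrable_finsetSum _ hint), integral_finsetSum _ hint]
  have hdev : ∑ b ∈ Finset.Ico 1 B, ∫ ω,
      (deviationEvent d M (popularity P d) (F + b * L + 1)).indicator (1 : Ω → ℝ) ω ∂P ≤
      F * (Real.pi ^ 2 / (3 * L)) / L := by
    refine (Finset.sum_le_sum fun b _ => ?_).trans (sum_one_div_sq_le (F := F) hL B)
    rw [integral_indicator_one (hmeas b)]
    exact measureReal_deviationEvent_le hd hM.nonanticipating (by omega)
  rw [integral_const, probReal_univ, one_smul]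
  calc _ ≤ F * ((x + L - 1) / L) + F * (Real.pi ^ 2 / (3 * L)) / L := by gcongr
    _ = _ := by ring

end IsCUCBSC

end Regret

end Caching

end

/-! ### Assembling the regret bound. -/

theorem theorem2 {F : ℕ} (hF : 1 ≤ F) (I : Caching.Infostation F)
    {Ω : Type*} {mΩ : MeasurableSpace Ω} (P : Measure Ω) [IsProbabilityMeasure P]
    (ℱ : Filtration ℕ mΩ) (d : ℕ → Fin F → Ω → ℝ) (hd : Caching.IsIIDDemand P ℱ d)
    (θ : Fin F → ℝ) (hθ : θ = Caching.popularity P d)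
    (hunique : ∃! A, I.IsOptimal θ A)
    (g : ℝ ≃ₗ[ℝ] ℝ) (hg : I.IsRewardModulus g)
    (w : ℝ) (hw : 0 ≤ w) (L : ℕ) (hL : 1 ≤ L)
    (M : ℕ → Ω → Finset (Fin F)) (hM : Caching.IsCUCBSC I P ℱ d (fun _ => L) M)
    (t : ℕ) (ht : 1 ≤ t) :
    Caching.regret I P θ w M t ≤
        6 * F * Real.log t / (g.symm (I.gapMin θ)) ^ 2 *
            (I.gapMax θ + w * (2 * I.maxSwitchCost / L))
          + F * I.gapMax θ * (Real.pi ^ 2 / 3 + L)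
          + w * F * (2 * I.maxSwitchCost) / L *
              (Real.pi ^ 2 / (3 * L) + 3 * L / 2 - 1
                + Real.log (1 + ((L : ℝ) - 1) / (F + 1)) / (g.symm (I.gapMin θ)) ^ 2) ∧
      (w = 0 → L = 1 →
        Caching.regret I P θ w M t ≤
          (6 * Real.log t / (g.symm (I.gapMin θ)) ^ 2 + Real.pi ^ 2 / 3 + 1)
            * F * I.gapMax θ) := by
  suffices h : Caching.regret I P θ w M t ≤ 6 * F * Real.log t / (g.symm (I.gapMin θ)) ^ 2 *
            (I.gapMax θ + w * (2 * I.maxSwitchCost / L))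
          + F * I.gapMax θ * (Real.pi ^ 2 / 3 + L)
          + w * F * (2 * I.maxSwitchCost) / L *
              (Real.pi ^ 2 / (3 * L) + 3 * L / 2 - 1
                + Real.log (1 + ((L : ℝ) - 1) / (F + 1)) / (g.symm (I.gapMin θ)) ^ 2) by
    refine ⟨h, fun hw0 hL1 => h.trans_eq ?_⟩
    subst hw0 hL1
    push_cast
    ring
  have hθ01 : ∀ f, θ f ∈ Set.Icc (0 : ℝ) 1 := fun f => hθ ▸ hd.popularity_mem_Icc f
  have hsingle := hM.feasible_singleton ⟨0, hF⟩
  have hempty := hsingle.mono (Finset.empty_subset _)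
  have hbad := Caching.Infostation.bad_empty (fun f => (hθ01 f).1) hsingle hunique
  have hD := hg.symm_gapMin_pos hsingle hbad
  have hD1 := hg.symm_gapMin_le_one hθ01 hsingle hunique
  have hgap := hbad.gapMax_pos.le
  have hMu := I.maxSwitchCost_nonneg hempty
  have hcap := I.maxSwitchCost_le_capacity hempty
  have hL1 : (1 : ℝ) ≤ L := by exact_mod_cast hL
  have hF0 : (0 : ℝ) ≤ F := Nat.cast_nonneg F
  have hlogt : 0 ≤ Real.log t := Real.log_natCast_nonneg t
  -- `B` counts the blocks started by period `t`. Completing the last one only adds nonnegative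
  -- terms, while every logarithm stays at most `log t`.
  obtain ⟨B, htB, hBt⟩ : ∃ B, t ≤ F + B * L ∧ ∀ b < B, F + b * L + 1 ≤ t := by
    refine ⟨(t + L - (F + 1)) / L, ?_, fun b hb => ?_⟩
    · have h1 := Nat.div_add_mod' (t + L - (F + 1)) L
      have h2 := Nat.mod_lt (t + L - (F + 1)) (by omega : 0 < L)
      omega
    · have h1 := (Nat.le_div_iff_mul_le (by omega : 0 < L)).1 (Nat.succ_le_of_lt hb)
      rw [Nat.succ_mul] at h1
      omega
  set D := g.symm (I.gapMin θ) with hDdef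
  set x := 6 * Real.log t / D ^ 2 with hxdef
  have hx : 0 ≤ x := by positivity
  -- Once a block has started, `t ≥ F + 1 ≥ 2`, and `6 log 2 > 1 ≥ D²`.
  have hx1 : B ≠ 0 → 1 ≤ x := by
    intro hB
    have ht2 := hBt 0 (by omega)
    have ht2' : (2 : ℝ) ≤ t := by exact_mod_cast (by omega : 2 ≤ t)
    have hlog := Real.log_le_log two_pos ht2'
    rw [hxdef, le_div_iff₀ (by positivity)]
    nlinarith [Real.log_two_gt_d9]
  have hN : ∫ ω, Caching.badCount I θ M L B ω ∂P ≤
      F * (x + L - 1 + Real.pi ^ 2 / (3 * L)) / L := by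
    subst hθ
    refine hM.integral_badCount_le hd hF hL hunique hg hx hx1 fun b hb => ?_
    rw [hxdef]
    gcongr
    exact hBt b hb
  set N := ∫ ω, Caching.badCount I θ M L B ω ∂P with hNdef
  have hNint := hM.integrable_badCount (θ := θ) B
  have hfeas := hM.feasible hL hempty
  have hsubset := Finset.Icc_subset_Icc_right (a := 1) htB
  have hsamp : Caching.samplingRegret I P θ M t ≤ I.gapMax θ * (F + L * N) := by
    have hint : Integrable (fun ω => ∑ i ∈ Finset.Icc 1 t, I.reward θ (M i ω)) P :=
      integrable_finsetSum _ fun i _ => hM.integrable_comp (fun A _ => I.reward θ A) i 0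
    have heq : Caching.samplingRegret I P θ M t =
        ∫ ω, (t * I.optReward θ - ∑ i ∈ Finset.Icc 1 t, I.reward θ (M i ω)) ∂P := by
      rw [integral_sub (integrable_const _) hint]
      simp [Caching.samplingRegret]
    have hrhs : I.gapMax θ * (F + L * N) =
        ∫ ω, I.gapMax θ * (F + L * Caching.badCount I θ M L B ω) ∂P := by
      rw [integral_const_mul, integral_add (integrable_const _) (hNint.const_mul _),
        integral_const_mul]
      simp [hNdef]
    rw [heq, hrhs]
    refine integral_mono_ae ((integrable_const _).sub hint)
      (((integrable_const _).add (hNint.const_mul _)).const_mul _) ?_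
    filter_upwards [hfeas] with ω hω
    refine le_trans ?_ (Caching.sum_gap_le (fun i _ => hω i) hgap (hM.keep_block ω) B)
    refine le_trans (le_of_eq ?_) (Finset.sum_le_sum_of_subset_of_nonneg hsubset fun i _ _ =>
      sub_nonneg.2 (I.reward_le_optReward (hω i)))
    rw [Finset.sum_sub_distrib]
    simp
  have hswitch : Caching.switchingRegret I P M t ≤ (F + 2 * N) * I.maxSwitchCost := by
    have hint : Integrable (fun ω => ∑ i ∈ Finset.Icc 1 t,
        I.switchCost (M i ω) (M (i - 1) ω)) P :=
      integrable_finsetSum _ fun i _ => hM.integrable_comp I.switchCost i (i - 1)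
    have hrhs : (F + 1 + 2 * N) * I.maxSwitchCost =
        ∫ ω, (F + 1 + 2 * Caching.badCount I θ M L B ω) * I.maxSwitchCost ∂P := by
      rw [integral_mul_const, integral_add (integrable_const _) (hNint.const_mul _),
        integral_const_mul]
      simp [hNdef]
    have hle : ∫ ω, ∑ i ∈ Finset.Icc 1 t, I.switchCost (M i ω) (M (i - 1) ω) ∂P ≤
        (F + 1 + 2 * N) * I.maxSwitchCost := by
      rw [hrhs]
      refine integral_mono_ae hint
        (((integrable_const _).add (hNint.const_mul _)).mul_const _) ?_
      filter_upwards [hfeas] with ω hω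
      exact (Finset.sum_le_sum_of_subset_of_nonneg hsubset fun i _ _ =>
        I.switchCost_nonneg _ _).trans
          (Caching.sum_switchCost_le hL hω hunique (hM.keep_block ω) B)
    rw [Caching.switchingRegret]
    linarith
  have hLN : L * N ≤ F * (x + L - 1 + Real.pi ^ 2 / 3) := by
    rw [le_div_iff₀ (by linarith), mul_comm] at hN
    refine hN.trans ?_
    gcongr
    linarith
  -- This term of the stated bound is pure slack: the estimate already holds without it.
  have hlogL : 0 ≤ Real.log (1 + ((L : ℝ) - 1) / (F + 1)) / D ^ 2 :=
    div_nonneg (Real.log_nonneg (le_add_of_nonneg_right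
      (div_nonneg (by linarith) (by linarith)))) (by positivity)
  have hsamp' : Caching.samplingRegret I P θ M t ≤
      F * x * I.gapMax θ + F * I.gapMax θ * (Real.pi ^ 2 / 3 + L) := by
    refine hsamp.trans ?_
    have := mul_le_mul_of_nonneg_left hLN hgap
    linarith
  have hswitch' : Caching.switchingRegret I P M t ≤
      F * (2 * I.maxSwitchCost) / L * (x + (Real.pi ^ 2 / (3 * L) + 3 * L / 2 - 1
        + Real.log (1 + ((L : ℝ) - 1) / (F + 1)) / D ^ 2)) := by
    refine hswitch.trans ?_
    have h1 : (F + 2 * N) * I.maxSwitchCost ≤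
        (F + 2 * (F * (x + L - 1 + Real.pi ^ 2 / (3 * L)) / L)) * I.maxSwitchCost := by
      gcongr
    -- The `F` initial switches equal `(2F/L) · (L/2)`, which turns `L - 1` into `3L/2 - 1`.
    have h2 : (F + 2 * (F * (x + L - 1 + Real.pi ^ 2 / (3 * L)) / L)) * I.maxSwitchCost =
        F * (2 * I.maxSwitchCost) / L * (x + (Real.pi ^ 2 / (3 * L) + 3 * L / 2 - 1)) := by
      field_simp
      ring
    have h3 : 0 ≤ F * (2 * I.maxSwitchCost) / L *
        (Real.log (1 + ((L : ℝ) - 1) / (F + 1)) / D ^ 2) := by positivity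
    linarith
  rw [Caching.regret]
  have hw' := mul_le_mul_of_nonneg_left hswitch' hw
  have hxF : 6 * F * Real.log t / D ^ 2 = F * x := by
    rw [hxdef]
    ring
  rw [hxF]
  refine (add_le_add hsamp' hw').trans (le_of_eq ?_)
  ring
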